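/- Consider a time-varying system $\dot x=f(t,x)$, where $f:\mathbb R_+\times\mathbb R^n\to\mathbb R^n$ is continuously differentiable in $x$, with Jacobian $J(t,x)=\frac{\partial f}{\partial x}(t,x)$ continuous in $(t,x)$. Let $\Omega\subseteq\mathbb R^n$ be a closed connected $n$-dimensional manifold (possibly with boundary; it suffices that $\Omega$ is a closed connected set which is the closure of its interior), and suppose that for every $a\in\Omega$ the solution $x(t,a)$ with $x(0,a)=a$ exists and stays in $\Omega$ for all $t\ge 0$. Trajectories below are solutions in $\Omega$ on $[0,\infty)$. "Some norm" means an arbitrary vector norm, which may differ from one condition to the next. For $A\in\mathbb R^{n\times n}$ and $k\in\{1,\dots,n\}$ let $A^{(k)}$ be the $k$-th multiplicative compound (the $\binom nk\times\binom nk$ matrix of all minors of order $k$), and $A^{[k]}=\frac{d}{d\varepsilon}(I_n+\varepsilon A)^{(k)}|_{\varepsilon=0}$ the $k$-th additive compound. Let $k\in\{1,\dots,n\}$ and $\ell=n-k+1$. Let $H(x)\in\mathbb R^{n\times \ell}$ and $Q(x)\in\mathbb R^{n\times(n-\ell)}$ be continuously differentiable on $\Omega$ and such that, for every $x\in\Omega$,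 $H(x)^TQ(x)=0$ and every $v\in\mathbb R^n$ is uniquely of the form $v=H(x)v_h+Q(x)v_q$. Put $M(x)=\begin{bmatrix}H(x)^T\\ Q(x)^T\end{bmatrix}\in\mathbb R^{n\times n}$. Assume: 1. (Horizontal contraction with respect to the distribution spanned by the columns of $H$.) There are $c\ge1$, $\eta>0$ and some norm such that for every trajectory $x(t)$ and every solution $\delta x(t)=H(x(t))\,\delta x_h(t)+Q(x(t))\,\delta x_q(t)$ of $\dot{\delta x}=J(t,x(t))\,\delta x$ one has $|\delta x_h(t)|\le c\,e^{-\eta t}|\delta x_h(0)|$ for all $t\ge0$. 2. Each of the three matrix functions $A=H^TH$, $A=M$, $A=M^{(k)}$ is uniformly bounded with uniformly bounded inverse on $\Omega$: there are constants $c,c'>0$ and some norm such that $c|y|\le|A(x)y|\le c'|y|$ for all $x\in\Omega$ and all vectors $y$. 3. (Uniform incremental stability.) There are $\gamma>1$ and some norm such that any two trajectories satisfy $|x^1(t)-x^2(t)|\le\gamma|x^1(0)-x^2(0)|$ for all $t\ge0$. Then the system is $k$-contractive on $\Omega$: there are $c\ge1$, $\eta>0$ and a norm on $\mathbb R^{\binom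 nk}$ such that for every trajectory $x(t)$ every solution of the $k$-th compound equation $\dot y=J^{[k]}(t,x(t))\,y$ satisfies $|y(t)|\le c\,e^{-\eta t}|y(0)|$ for all $t\ge0$. -/

import Mathlib

open Matrix Set

noncomputable section

/-- A vector norm on `ℝ^ι`: a positive definite seminorm. -/
def IsVectorNorm {ι : Type} (N : Seminorm ℝ (ι → ℝ)) : Prop :=
  ∀ v, N v = 0 → v = 0

/-! ### Compound matrices -/

/-- The `k`-th multiplicative compound: all `k × k` minors of `A`. The rows and columns are indexed
by the strictly increasing sequences of `k` row, respectively column, indices. -/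
def multCompound (k : ℕ) {m n : ℕ} (A : Matrix (Fin m) (Fin n) ℝ) :
    Matrix (Fin k ↪o Fin m) (Fin k ↪o Fin n) ℝ :=
  Matrix.of fun α β => (A.submatrix α β).det

/-- The `k`-th additive compound: the derivative at `ε = 0` of `(I + ε A)^{(k)}`, entry by entry
(every entry is a polynomial in `ε`). -/
def addCompound (k : ℕ) {n : ℕ} (A : Matrix (Fin n) (Fin n) ℝ) :
    Matrix (Fin k ↪o Fin n) (Fin k ↪o Fin n) ℝ :=
  Matrix.of fun α β => deriv (fun ε : ℝ => multCompound k (1 + ε • A) α β) 0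

/-! ### The system `ẋ = f(t, x)` and linear time-varying systems -/

/-- The Jacobian matrix of `f(t, ·)` at `x`. -/
def jacobian {n : ℕ} (f : ℝ → (Fin n → ℝ) → (Fin n → ℝ)) (t : ℝ) (x : Fin n → ℝ) :
    Matrix (Fin n) (Fin n) ℝ :=
  LinearMap.toMatrix' (fderiv ℝ (f t) x).toLinearMap

/-- `u` is a trajectory in `Ω` of `ẋ = f(t, x)`, on `t ≥ 0`. -/
def IsTrajectory {n : ℕ} (f : ℝ → (Fin n → ℝ) → (Fin n → ℝ)) (Ω : Set (Fin n → ℝ))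
    (u : ℝ → (Fin n → ℝ)) : Prop :=
  ∀ t, 0 ≤ t → u t ∈ Ω ∧ HasDerivWithinAt u (f t (u t)) (Ici 0) t

/-- `y` is a solution, on `t ≥ 0`, of the linear time-varying system `ẏ = A(t) y`. -/
def IsLinearSolution {ι : Type} [Fintype ι] (A : ℝ → Matrix ι ι ℝ) (y : ℝ → (ι → ℝ)) : Prop :=
  ∀ t, 0 ≤ t → HasDerivWithinAt y (A t *ᵥ y t) (Ici 0) t

/-- `k`-contraction: uniform exponential stability, along all trajectories, of the `k`-th compound
equation `ẏ = J^{[k]}(t, x(t)) y`, with the same norm and constants for all trajectories. -/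
def IsKContractive {n : ℕ} (f : ℝ → (Fin n → ℝ) → (Fin n → ℝ)) (Ω : Set (Fin n → ℝ))
    (k : ℕ) : Prop :=
  ∃ N : Seminorm ℝ ((Fin k ↪o Fin n) → ℝ), IsVectorNorm N ∧
  ∃ c : ℝ, 1 ≤ c ∧ ∃ η : ℝ, 0 < η ∧
    ∀ u, IsTrajectory f Ω u →
    ∀ y, IsLinearSolution (fun t => addCompound k (jacobian f t (u t))) y →
    ∀ t, 0 ≤ t → N (y t) ≤ c * Real.exp (-η * t) * N (y 0)

/-- Uniform incremental stability of the system on `Ω`. -/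
def IsUniformlyIncrementallyStable {n : ℕ} (f : ℝ → (Fin n → ℝ) → (Fin n → ℝ))
    (Ω : Set (Fin n → ℝ)) : Prop :=
  ∃ N : Seminorm ℝ (Fin n → ℝ), IsVectorNorm N ∧
  ∃ γ : ℝ, 1 < γ ∧
    ∀ u v, IsTrajectory f Ω u → IsTrajectory f Ω v →
    ∀ t, 0 ≤ t → N (u t - v t) ≤ γ * N (u 0 - v 0)

/-! ### Horizontal and vertical distributions -/

/-- The columns of `H(x)` and `Q(x)` span orthogonally complementary distributions on `Ω` of
dimensions `ℓ` and `n - ℓ`, and depend on `x` in a continuously differentiable way. -/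
structure IsHorizontalSplitting {n ℓ : ℕ} (Ω : Set (Fin n → ℝ))
    (H : (Fin n → ℝ) → Matrix (Fin n) (Fin ℓ) ℝ)
    (Q : (Fin n → ℝ) → Matrix (Fin n) (Fin (n - ℓ)) ℝ) : Prop where
  contDiffOn_H : ∀ j, ContDiffOn ℝ 1 (fun x => (H x)ᵀ j) Ω
  contDiffOn_Q : ∀ j, ContDiffOn ℝ 1 (fun x => (Q x)ᵀ j) Ω
  orthogonal : ∀ x ∈ Ω, (H x)ᵀ * Q x = 0
  decomposition : ∀ x ∈ Ω, ∀ v : Fin n → ℝ,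
    ∃! p : (Fin ℓ → ℝ) × (Fin (n - ℓ) → ℝ), v = H x *ᵥ p.1 + Q x *ᵥ p.2

/-- Horizontal contraction with respect to the distribution spanned by the columns of `H`: along
every trajectory, the horizontal coordinates `ξ` of the solutions `w = H ξ + Q ζ` of the variational
equation decay exponentially, uniformly over all trajectories. -/
def IsHorizontallyContractive {n ℓ : ℕ} (f : ℝ → (Fin n → ℝ) → (Fin n → ℝ))
    (Ω : Set (Fin n → ℝ))
    (H : (Fin n → ℝ) → Matrix (Fin n) (Fin ℓ) ℝ)
    (Q : (Fin n → ℝ) → Matrix (Fin n) (Fin (n - ℓ)) ℝ) : Prop :=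
  ∃ N : Seminorm ℝ (Fin ℓ → ℝ), IsVectorNorm N ∧
  ∃ c : ℝ, 1 ≤ c ∧ ∃ η : ℝ, 0 < η ∧
    ∀ u, IsTrajectory f Ω u →
    ∀ w, IsLinearSolution (fun t => jacobian f t (u t)) w →
    ∀ (ξ : ℝ → (Fin ℓ → ℝ)) (ζ : ℝ → (Fin (n - ℓ) → ℝ)),
    (∀ t, 0 ≤ t → w t = H (u t) *ᵥ ξ t + Q (u t) *ᵥ ζ t) →
    ∀ t, 0 ≤ t → N (ξ t) ≤ c * Real.exp (-η * t) * N (ξ 0)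

/-- The `n × n` matrix whose first `ℓ` rows are those of `Hᵀ` and whose last `n - ℓ` rows are those
of `Qᵀ`. -/
def stackTranspose {n ℓ : ℕ} (H : Matrix (Fin n) (Fin ℓ) ℝ)
    (Q : Matrix (Fin n) (Fin (n - ℓ)) ℝ) : Matrix (Fin n) (Fin n) ℝ :=
  Matrix.of fun i j =>
    if h : (i : ℕ) < ℓ then Hᵀ ⟨i, h⟩ j else Qᵀ ⟨i - ℓ, by omega⟩ j

/-- `c |y| ≤ |A(x) y| ≤ c' |y|` for all `x ∈ Ω` and all `y`, with some vector norm and some positive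
constants `c`, `c'`. -/
def HasUniformBounds {n : ℕ} {ι : Type} [Fintype ι] (Ω : Set (Fin n → ℝ))
    (A : (Fin n → ℝ) → Matrix ι ι ℝ) : Prop :=
  ∃ N : Seminorm ℝ (ι → ℝ), IsVectorNorm N ∧
  ∃ c : ℝ, 0 < c ∧ ∃ c' : ℝ, 0 < c' ∧
    ∀ x ∈ Ω, ∀ y, c * N y ≤ N (A x *ᵥ y) ∧ N (A x *ᵥ y) ≤ c' * N y

end

/-! ### Compound matrices -/

/-! Let `X` be the fundamental matrix of the variational equation along a trajectory, with `X(0) =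
I`. By Cauchy–Binet its compound `X^{(k)}` is the fundamental matrix of the `k`-th compound equation
(`hasDerivWithinAt_multCompound`), so it suffices to make `X^{(k)}` decay exponentially, uniformly
over trajectories. The first `ℓ` rows of `M X` are `Hᵀ X = (HᵀH) δx_h`, which decay by horizontal
contraction. The remaining rows stay bounded: incremental stability bounds difference quotients of
trajectories, and hence variational solutions (`norm_variational_solution_le`). Since `ℓ = n - k +
1`, only `k - 1` rows lie outside the first `ℓ`, so each `k`-minor of `M X` contains a decaying row
(`abs_multCompound_le`) and decays at the horizontal rate. Finally `(M X)^{(k)} = M^{(k)} X^{(k)}`,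
and the uniformly bounded inverse of `M^{(k)}` passes the decay to `X^{(k)}`. -/

theorem prod_mul_det_submatrix_sum_perm {k n : ℕ} (A : Matrix (Fin k) (Fin n) ℝ)
    (B : Matrix (Fin n) (Fin k) ℝ) (α : Fin k ↪o Fin n) :
    ∑ σ : Equiv.Perm (Fin k), (∏ i, A i (α (σ i))) * (B.submatrix (α ∘ σ) id).det =
      (A.submatrix id α).det * (B.submatrix α id).det := by
  rw [← Matrix.det_transpose (A.submatrix id α), Matrix.det_apply', Finset.sum_mul]
  refine Finset.sum_congr rfl fun σ _ => ?_
  have h : (B.submatrix (α ∘ σ) id) = (B.submatrix α id).submatrix σ id := rfl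
  rw [h, Matrix.det_permute]
  simp only [Matrix.transpose_apply, Matrix.submatrix_apply, id]
  ring

/-- The Cauchy–Binet formula. -/
theorem det_mul_eq_sum_orderEmbedding {k n : ℕ} (A : Matrix (Fin k) (Fin n) ℝ)
    (B : Matrix (Fin n) (Fin k) ℝ) :
    (A * B).det =
      ∑ α : Fin k ↪o Fin n, (A.submatrix id α).det * (B.submatrix α id).det := by
  have expand : (A * B).det =
      ∑ p : Fin k → Fin n, (∏ i, A i (p i)) * (B.submatrix p id).det := by
    have h1 : (A * B : Matrix _ _ ℝ) = fun i => ∑ j, A i j • B j := by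
      ext i j
      simp [Matrix.mul_apply]
    have h2 := (Matrix.detRowAlternating (n := Fin k) (R := ℝ)).toMultilinearMap.map_sum
      (fun (i : Fin k) (j : Fin n) => A i j • B j)
    have h3 : (A * B).det = ∑ p : Fin k → Fin n,
        (Matrix.detRowAlternating (n := Fin k) (R := ℝ)).toMultilinearMap
          (fun i => A i (p i) • B (p i)) := by
      rw [← h2, h1]; rfl
    rw [h3]
    refine Finset.sum_congr rfl fun p _ => ?_
    rw [MultilinearMap.map_smul_univ]
    rfl
  rw [expand]
  simp_rw [← prod_mul_det_submatrix_sum_perm A B]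
  rw [← Fintype.sum_prod_type'
    (f := fun (α : Fin k ↪o Fin n) (σ : Equiv.Perm (Fin k)) =>
      (∏ i, A i (α (σ i))) * (B.submatrix (α ∘ σ) id).det)]
  symm
  -- An injective index map factors uniquely as an increasing one after a permutation; a
  -- non-injective one repeats a row and contributes zero.
  refine Finset.sum_of_injOn
    (fun q : (Fin k ↪o Fin n) × Equiv.Perm (Fin k) => (q.1 ∘ q.2 : Fin k → Fin n))
    ?_ (fun _ _ => by simp) ?_ (fun _ _ => rfl)
  · rintro ⟨α, σ⟩ - ⟨β, τ⟩ - h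
    simp only at h
    have hr : range α = range β := by
      rw [← σ.surjective.range_comp α, h, τ.surjective.range_comp]
    have hαβ : α = β :=
      DFunLike.coe_injective ((α.strictMono.range_inj β.strictMono).1 hr)
    subst hαβ
    have : σ = τ := Equiv.ext fun i => α.injective (congrFun h i)
    rw [this]
  · intro p _ hp
    have hnot : ¬ Function.Injective p := by
      intro hinj
      refine hp ⟨⟨OrderEmbedding.ofStrictMono (p ∘ Tuple.sort p)
        ((Tuple.monotone_sort p).strictMono_of_injective
          (hinj.comp (Tuple.sort p).injective)), (Tuple.sort p)⁻¹⟩, by simp, ?_⟩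
      funext i
      simp
    rw [Function.Injective] at hnot
    push Not at hnot
    obtain ⟨i, j, hij, hne⟩ := hnot
    rw [Matrix.det_zero_of_row_eq hne (by ext; simp [hij]), mul_zero]

theorem multCompound_mul (k : ℕ) {l m n : ℕ} (A : Matrix (Fin l) (Fin m) ℝ)
    (B : Matrix (Fin m) (Fin n) ℝ) :
    multCompound k (A * B) = multCompound k A * multCompound k B := by
  ext α β
  have h : (A * B).submatrix α β = A.submatrix α id * B.submatrix id β := by
    ext; simp [Matrix.mul_apply]
  simp only [multCompound, Matrix.of_apply, Matrix.mul_apply, h, det_mul_eq_sum_orderEmbedding]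
  rfl

theorem multCompound_one (k n : ℕ) :
    multCompound k (1 : Matrix (Fin n) (Fin n) ℝ) = 1 := by
  ext α β
  simp only [multCompound, Matrix.of_apply]
  by_cases h : α = β
  · subst h
    rw [Matrix.submatrix_one _ α.injective, Matrix.det_one, Matrix.one_apply_eq]
  · rw [Matrix.one_apply_ne h]
    -- Distinct index sets of equal size are not nested, so the minor has a zero row.
    have : ∃ i, α i ∉ range β := by
      by_contra! hc
      have hsub : range α ⊆ range β := by rintro _ ⟨i, rfl⟩; exact hc i
      have hcard : (range β).ncard ≤ (range α).ncard := by
        rw [← image_univ, ← image_univ, ncard_image_of_injective _ α.injective,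
          ncard_image_of_injective _ β.injective]
      have := Set.eq_of_subset_of_ncard_le hsub hcard (Set.toFinite _)
      exact h (DFunLike.coe_injective ((α.strictMono.range_inj β.strictMono).1 this))
    obtain ⟨i, hi⟩ := this
    refine Matrix.det_eq_zero_of_row_eq_zero i fun j => ?_
    simp only [Matrix.submatrix_apply]
    exact Matrix.one_apply_ne fun hij => hi ⟨j, hij.symm⟩

theorem contDiff_multCompound_apply (k : ℕ) {m n : ℕ} (α : Fin k ↪o Fin m) (β : Fin k ↪o Fin n) :
    ContDiff ℝ 1 (fun A : Fin m → Fin n → ℝ => multCompound k (Matrix.of A) α β) := by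
  simp only [multCompound, Matrix.of_apply, Matrix.det_apply', Matrix.submatrix_apply]
  fun_prop

/-- The derivative of the multiplicative compound at the identity. -/
theorem addCompound_apply_eq_fderiv (k : ℕ) {n : ℕ} (A : Matrix (Fin n) (Fin n) ℝ)
    (α β : Fin k ↪o Fin n) :
    addCompound k A α β =
      fderiv ℝ (fun A : Fin n → Fin n → ℝ => multCompound k (Matrix.of A) α β)
        (Matrix.of.symm (1 : Matrix (Fin n) (Fin n) ℝ)) (Matrix.of.symm A) := by
  have hd : HasDerivAt (fun ε : ℝ => Matrix.of.symm (1 : Matrix (Fin n) (Fin n) ℝ)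
      + ε • Matrix.of.symm A) (Matrix.of.symm A) 0 := by
    simpa using ((hasDerivAt_id (0 : ℝ)).smul_const (Matrix.of.symm A)).const_add
      (Matrix.of.symm (1 : Matrix (Fin n) (Fin n) ℝ))
  have hF := ((contDiff_multCompound_apply k α β).differentiable one_ne_zero).differentiableAt
    (x := Matrix.of.symm (1 : Matrix (Fin n) (Fin n) ℝ) + (0 : ℝ) • Matrix.of.symm A)
  have := (hF.hasFDerivAt.comp_hasDerivAt 0 hd).deriv
  simp only [addCompound, Matrix.of_apply]
  rw [zero_smul, add_zero] at this
  exact this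

/-- By the chain rule only the derivative of the compound at `X` in the direction `A X` matters. On
the line `X + ε A X = (I + ε A) X` multiplicativity reduces it to the derivative at the identity,
which is the additive compound. -/
theorem hasDerivWithinAt_multCompound (k : ℕ) {n : ℕ} {A : Matrix (Fin n) (Fin n) ℝ}
    {X : ℝ → Matrix (Fin n) (Fin n) ℝ} {s : Set ℝ} {t : ℝ}
    (hX : ∀ i j, HasDerivWithinAt (fun t => X t i j) ((A * X t) i j) s t)
    (α β : Fin k ↪o Fin n) :
    HasDerivWithinAt (fun t => multCompound k (X t) α β)
      ((addCompound k A * multCompound k (X t)) α β) s t := by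
  have hX' : HasDerivWithinAt (fun t => Matrix.of.symm (X t)) (Matrix.of.symm (A * X t)) s t :=
    hasDerivWithinAt_pi.2 fun i => hasDerivWithinAt_pi.2 fun j => hX i j
  have hF := ((contDiff_multCompound_apply k α β).differentiable one_ne_zero).differentiableAt
    (x := Matrix.of.symm (X t))
  have h1 := hF.hasFDerivAt.comp_hasDerivWithinAt t hX'
  have hd : HasDerivAt (fun ε : ℝ => Matrix.of.symm (X t) + ε • Matrix.of.symm (A * X t))
      (Matrix.of.symm (A * X t)) 0 := by
    simpa using ((hasDerivAt_id (0 : ℝ)).smul_const (Matrix.of.symm (A * X t))).const_add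
      (Matrix.of.symm (X t))
  have hF0 := ((contDiff_multCompound_apply k α β).differentiable one_ne_zero).differentiableAt
    (x := Matrix.of.symm (X t) + (0 : ℝ) • Matrix.of.symm (A * X t))
  have h2 := hF0.hasFDerivAt.comp_hasDerivAt 0 hd
  rw [zero_smul, add_zero] at h2
  have h3 : (fun ε : ℝ => multCompound k (X t + ε • (A * X t)) α β) =
      fun ε => ∑ γ, multCompound k (1 + ε • A) α γ * multCompound k (X t) γ β := by
    funext ε
    have : X t + ε • (A * X t) = (1 + ε • A) * X t := by
      rw [add_mul, one_mul, Matrix.smul_mul]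
    rw [this, multCompound_mul, Matrix.mul_apply]
  have h4 : HasDerivAt (fun ε : ℝ => multCompound k (X t + ε • (A * X t)) α β)
      ((addCompound k A * multCompound k (X t)) α β) 0 := by
    rw [h3, Matrix.mul_apply]
    refine HasDerivAt.fun_sum fun γ _ => HasDerivAt.mul_const ?_ _
    have hd1 : HasDerivAt (fun ε : ℝ => Matrix.of.symm (1 : Matrix (Fin n) (Fin n) ℝ)
        + ε • Matrix.of.symm A) (Matrix.of.symm A) 0 := by
      simpa using ((hasDerivAt_id (0 : ℝ)).smul_const (Matrix.of.symm A)).const_add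
        (Matrix.of.symm (1 : Matrix (Fin n) (Fin n) ℝ))
    have hF1 := ((contDiff_multCompound_apply k α γ).differentiable one_ne_zero).differentiableAt
      (x := Matrix.of.symm (1 : Matrix (Fin n) (Fin n) ℝ) + (0 : ℝ) • Matrix.of.symm A)
    exact (hF1.hasFDerivAt.comp_hasDerivAt 0 hd1).differentiableAt.hasDerivAt
  rw [h4.unique h2]
  exact h1

theorem continuous_addCompound (k n : ℕ) :
    Continuous (addCompound k : Matrix (Fin n) (Fin n) ℝ → _) := by
  refine continuous_matrix fun α β => ?_
  simp_rw [addCompound_apply_eq_fderiv]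
  exact (ContinuousLinearMap.continuous _).comp continuous_id

/-- A determinant whose rows are bounded entrywise by `b`. -/
theorem abs_det_le_of_row_bound {k : ℕ} (X : Matrix (Fin k) (Fin k) ℝ) (b : Fin k → ℝ)
    (hb : ∀ i j, |X i j| ≤ b i) : |X.det| ≤ k.factorial * ∏ i, b i := by
  rw [← Matrix.det_transpose, Matrix.det_apply']
  refine (Finset.abs_sum_le_sum_abs _ _).trans ?_
  calc _ ≤ ∑ σ : Equiv.Perm (Fin k), ∏ i, b i := by
        refine Finset.sum_le_sum fun σ _ => ?_
        rw [abs_mul, Finset.abs_prod]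
        have : |((Equiv.Perm.sign σ : ℤ) : ℝ)| = 1 := by
          rcases Int.units_eq_one_or (Equiv.Perm.sign σ) with h | h <;> simp [h]
        rw [this, one_mul]
        exact Finset.prod_le_prod (fun _ _ => abs_nonneg _) fun i _ => hb i (σ i)
    _ = _ := by simp [Fintype.card_perm]

/-! ### Norms on `ℝ^ι` -/

section Norms
variable {ι : Type} [Fintype ι]

theorem Seminorm.exists_le_mul_norm (N : Seminorm ℝ (ι → ℝ)) :
    ∃ b, 0 < b ∧ ∀ v, N v ≤ b * ‖v‖ := by
  classical
  refine ⟨(∑ i, N (Pi.single i 1)) + 1, ?_, fun v => ?_⟩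
  · have : 0 ≤ ∑ i, N (Pi.single i (1 : ℝ)) := Finset.sum_nonneg fun _ _ => apply_nonneg _ _
    linarith
  · have hv : v = ∑ i, v i • (Pi.single i (1 : ℝ) : ι → ℝ) := by
      ext j
      simp [Finset.sum_apply, Pi.single_apply]
    have h1 : N v ≤ ∑ i, N (v i • (Pi.single i (1 : ℝ) : ι → ℝ)) := by
      conv_lhs => rw [hv]
      exact Finset.le_sum_of_subadditive N (map_zero N).le (map_add_le_add N) _ _
    have h2 : ∑ i, N (v i • (Pi.single i (1 : ℝ) : ι → ℝ)) ≤ ∑ i, ‖v‖ * N (Pi.single i 1) :=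
      Finset.sum_le_sum fun i _ => by
        rw [map_smul_eq_mul]
        exact mul_le_mul_of_nonneg_right (norm_le_pi_norm v i) (apply_nonneg _ _)
    rw [← Finset.mul_sum] at h2
    nlinarith [norm_nonneg v]

theorem IsVectorNorm.exists_norm_le_mul {N : Seminorm ℝ (ι → ℝ)} (hN : IsVectorNorm N) :
    ∃ a, 0 < a ∧ ∀ v, ‖v‖ ≤ a * N v := by
  obtain ⟨b, hb, hNb⟩ := N.exists_le_mul_norm
  have hcont : Continuous N := by
    refine (LipschitzWith.of_dist_le_mul (K := ⟨b, hb.le⟩) fun x y => ?_).continuous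
    rw [Real.dist_eq, dist_eq_norm]
    exact (abs_sub_map_le_sub N x y).trans (hNb _)
  -- The sphere is empty only when the space is trivial; otherwise the minimum of `N` on it is
  -- positive by compactness.
  rcases (Metric.sphere (0 : ι → ℝ) 1).eq_empty_or_nonempty with he | hne
  · refine ⟨1, one_pos, fun v => ?_⟩
    by_cases hv : v = 0
    · simp [hv]
    · have : ‖v‖⁻¹ • v ∈ Metric.sphere (0 : ι → ℝ) 1 := by
        simp [norm_smul, hv]
      simp [he] at this
  · obtain ⟨x, hx, hmin⟩ := (isCompact_sphere (0 : ι → ℝ) 1).exists_isMinOn hne hcont.continuousOn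
    have hx0 : x ≠ 0 := by rintro rfl; simp at hx
    have hpos : 0 < N x := lt_of_le_of_ne (apply_nonneg _ _) fun h => hx0 (hN x h.symm)
    refine ⟨(N x)⁻¹, inv_pos.2 hpos, fun v => ?_⟩
    by_cases hv : v = 0
    · simp [hv]
    · have hmem : ‖v‖⁻¹ • v ∈ Metric.sphere (0 : ι → ℝ) 1 := by
        simp [norm_smul, hv]
      have h := hmin hmem
      simp only [mem_ofPred_eq, map_smul_eq_mul, norm_inv, norm_norm] at h
      have hv' : 0 < ‖v‖ := norm_pos_iff.2 hv
      rw [inv_mul_eq_div, le_div_iff₀ hv'] at h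
      rw [inv_mul_eq_div, le_div_iff₀ hpos]
      linarith

/-- Equivalence of norms lets the differing norms of the hypotheses all be replaced by the sup norm.
-/
theorem HasUniformBounds.exists_norm {n : ℕ} {Ω : Set (Fin n → ℝ)}
    {A : (Fin n → ℝ) → Matrix ι ι ℝ} (h : HasUniformBounds Ω A) :
    ∃ C, 0 < C ∧ ∀ x ∈ Ω, ∀ y, ‖A x *ᵥ y‖ ≤ C * ‖y‖ ∧ ‖y‖ ≤ C * ‖A x *ᵥ y‖ := by
  obtain ⟨N, hN, c, hc, c', hc', h⟩ := h
  obtain ⟨b, hb, hNb⟩ := N.exists_le_mul_norm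
  obtain ⟨a, ha, hNa⟩ := hN.exists_norm_le_mul
  have hpos1 : 0 < a * c' * b := by positivity
  have hpos2 : 0 < a * c⁻¹ * b := by positivity
  refine ⟨a * c' * b + a * c⁻¹ * b, by positivity, fun x hx y => ⟨?_, ?_⟩⟩
  · calc ‖A x *ᵥ y‖ ≤ a * N (A x *ᵥ y) := hNa _
      _ ≤ a * (c' * (b * ‖y‖)) := by
          gcongr
          exact (h x hx y).2.trans (mul_le_mul_of_nonneg_left (hNb y) hc'.le)
      _ ≤ _ := by nlinarith [mul_nonneg hpos2.le (norm_nonneg y)]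
  · have h1 : N y ≤ c⁻¹ * N (A x *ᵥ y) := by
      rw [inv_mul_eq_div, le_div_iff₀ hc, mul_comm]
      exact (h x hx y).1
    calc ‖y‖ ≤ a * N y := hNa _
      _ ≤ a * (c⁻¹ * (b * ‖A x *ᵥ y‖)) := by
          gcongr
          exact h1.trans (mul_le_mul_of_nonneg_left (hNb _) (inv_pos.2 hc).le)
      _ ≤ _ := by nlinarith [mul_nonneg hpos1.le (norm_nonneg (A x *ᵥ y))]

theorem isVectorNorm_normSeminorm : IsVectorNorm (normSeminorm ℝ (ι → ℝ)) := fun _ hv =>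
  norm_eq_zero.1 hv

end Norms

/-! ### Linear time-varying differential equations -/

/-- Distance between an exact and an approximate solution of a linear equation. -/
theorem norm_sub_le_of_approx_linear_solution {E : Type*} [NormedAddCommGroup E] [NormedSpace ℝ E]
    {A : ℝ → E →L[ℝ] E} {K T ε : ℝ} (hK : 0 < K) (hA : ∀ t ∈ Ico 0 T, ‖A t‖ ≤ K)
    {z z' w : ℝ → E}
    (hzc : ContinuousOn z (Icc 0 T)) (hz : ∀ t ∈ Ico 0 T, HasDerivWithinAt z (z' t) (Ici t) t)
    (hz' : ∀ t ∈ Ico 0 T, ‖z' t - A t (z t)‖ ≤ ε)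
    (hwc : ContinuousOn w (Icc 0 T))
    (hw : ∀ t ∈ Ico 0 T, HasDerivWithinAt w (A t (w t)) (Ici t) t)
    (h0 : z 0 = w 0) :
    ∀ t ∈ Icc 0 T, ‖z t - w t‖ ≤ ε * ((Real.exp (K * t) - 1) / K) := by
  intro t ht
  lift K to NNReal using hK.le
  have hlip : ∀ t ∈ Ico 0 T, LipschitzOnWith K (fun x => A t x) univ := fun t ht =>
    ((A t).lipschitz.weaken (by exact_mod_cast hA t ht)).lipschitzOnWith
  have := dist_le_of_approx_trajectories_ODE_of_mem (δ := 0) (εf := ε) (εg := 0) hlip hzc hz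
    (fun t ht => by rw [dist_eq_norm]; exact hz' t ht) (fun _ _ => trivial) hwc hw
    (fun t _ => by simp) (fun _ _ => trivial) (by simp [h0]) t ht
  rw [dist_eq_norm] at this
  refine this.trans (le_of_eq ?_)
  rw [gronwallBound_of_K_ne_0 hK.ne']
  simp only [sub_zero, add_zero, zero_mul, zero_add]
  ring

theorem eq_of_linear_solution {E : Type*} [NormedAddCommGroup E] [NormedSpace ℝ E]
    {A : ℝ → E →L[ℝ] E} {T : ℝ} (hA : ContinuousOn A (Ici 0)) {z w : ℝ → E}
    (hzc : ContinuousOn z (Icc 0 T))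
    (hz : ∀ t ∈ Ico 0 T, HasDerivWithinAt z (A t (z t)) (Ici t) t)
    (hwc : ContinuousOn w (Icc 0 T))
    (hw : ∀ t ∈ Ico 0 T, HasDerivWithinAt w (A t (w t)) (Ici t) t)
    (h0 : z 0 = w 0) : ∀ t ∈ Icc 0 T, z t = w t := by
  intro t ht
  obtain ⟨K, hK⟩ := isCompact_Icc.exists_bound_of_continuousOn
    (hA.mono (Icc_subset_Ici_self : Icc 0 T ⊆ _))
  -- The Gronwall estimate divides by `K`, hence the maximum with 1.
  have := norm_sub_le_of_approx_linear_solution (K := max K 1) (ε := 0) (by positivity)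
    (fun t ht => (hK t (Ico_subset_Icc_self ht)).trans (le_max_left _ _)) hzc hz (by simp) hwc hw h0
    t ht
  rw [zero_mul] at this
  exact sub_eq_zero.1 (norm_le_zero_iff.1 this)

/-- Coordinatewise projection of `ℝ^n` to the closed ball of radius `R` in the sup norm. -/
noncomputable def cubeProj {n : ℕ} {R : ℝ} (hR : 0 ≤ R) (v : Fin n → ℝ) : Fin n → ℝ :=
  fun i => projIcc (-R) R (by linarith) (v i)

theorem lipschitzWith_cubeProj {n : ℕ} {R : ℝ} (hR : 0 ≤ R) :
    LipschitzWith 1 (cubeProj (n := n) hR) := by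
  refine LipschitzWith.of_dist_le_mul fun x y => ?_
  rw [NNReal.coe_one, one_mul]
  refine (dist_pi_le_iff dist_nonneg).2 fun i => ?_
  have := (LipschitzWith.projIcc (a := -R) (b := R) (by linarith)).dist_le_mul (x i) (y i)
  rw [NNReal.coe_one, one_mul] at this
  exact this.trans (dist_le_pi_dist x y i)

theorem cubeProj_of_norm_le {n : ℕ} {R : ℝ} (hR : 0 ≤ R) {v : Fin n → ℝ} (hv : ‖v‖ ≤ R) :
    cubeProj hR v = v := by
  funext i
  have := abs_le.1 ((Real.norm_eq_abs _ ▸ norm_le_pi_norm v i).trans hv)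
  simp [cubeProj, projIcc_of_mem _ (⟨this.1, this.2⟩ : v i ∈ Icc (-R) R)]

theorem norm_cubeProj_le {n : ℕ} {R : ℝ} (hR : 0 ≤ R) (v : Fin n → ℝ) : ‖cubeProj hR v‖ ≤ R := by
  refine (pi_norm_le_iff_of_nonneg hR).2 fun i => ?_
  rw [Real.norm_eq_abs, abs_le]
  exact (projIcc (-R) R (by linarith) (v i)).2

theorem norm_cubeProj_le_norm {n : ℕ} {R : ℝ} (hR : 0 ≤ R) (v : Fin n → ℝ) :
    ‖cubeProj hR v‖ ≤ ‖v‖ := by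
  have := (lipschitzWith_cubeProj hR).dist_le_mul v 0
  rwa [cubeProj_of_norm_le hR (v := 0) (by simpa), NNReal.coe_one, one_mul, dist_zero_right,
    dist_zero_right] at this

/-- A linear field is unbounded, which would limit the Picard–Lindelöf time. Truncating its argument
with `cubeProj` makes it bounded and still Lipschitz, so the solution lasts to `T`; Gronwall then
shows that the truncation is never active. -/
theorem exists_linear_solution_Icc {n : ℕ} {A : ℝ → (Fin n → ℝ) →L[ℝ] (Fin n → ℝ)}
    (hA : ContinuousOn A (Ici 0)) (x₀ : Fin n → ℝ) {T : ℝ} (hT : 0 ≤ T) :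
    ∃ w : ℝ → (Fin n → ℝ), w 0 = x₀ ∧
      ∀ t ∈ Icc 0 T, HasDerivWithinAt w (A t (w t)) (Icc 0 T) t := by
  have hAT : ContinuousOn A (Icc 0 T) := hA.mono Icc_subset_Ici_self
  obtain ⟨K, hK⟩ := isCompact_Icc.exists_bound_of_continuousOn hAT
  have hK0 : 0 ≤ K := (norm_nonneg _).trans (hK 0 ⟨le_rfl, hT⟩)
  -- The a priori Gronwall bound on `[0, T]`.
  set R : ℝ := ‖x₀‖ * Real.exp (K * T) with hRdef
  have hR : 0 ≤ R := by positivity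
  have hPL : IsPicardLindelof (fun t x => A t (cubeProj hR x)) (⟨0, le_rfl, hT⟩ : Icc 0 T) x₀
      (⟨K * R, by positivity⟩ * ⟨T, hT⟩) 0 ⟨K * R, by positivity⟩ (⟨K, hK0⟩ * 1) := by
    refine ⟨fun t ht => ?_, fun x _ => ?_, fun t ht x _ => ?_, ?_⟩
    · exact (((A t).lipschitz.weaken (by exact_mod_cast hK t ht)).comp
        (lipschitzWith_cubeProj hR)).lipschitzOnWith
    · exact hAT.clm_apply continuousOn_const
    · exact ((A t).le_opNorm _).trans (mul_le_mul (hK t ht) (norm_cubeProj_le hR x)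
        (norm_nonneg _) hK0)
    · change K * R * max (T - 0) (0 - 0) ≤ K * R * T - 0
      simp [hT]
  obtain ⟨w, hw0, hw⟩ := hPL.exists_eq_forall_mem_Icc_hasDerivWithinAt₀
  refine ⟨w, hw0, fun t ht => ?_⟩
  have hwc : ContinuousOn w (Icc 0 T) := fun t ht => (hw t ht).continuousWithinAt
  have hbd : ∀ t ∈ Icc 0 T, ‖w t‖ ≤ R := by
    intro t ht
    have := norm_le_gronwallBound_of_norm_deriv_right_le (δ := ‖x₀‖) (K := K) (ε := 0) hwc
      (f' := fun t => A t (cubeProj hR (w t)))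
      (fun t ht => (hw t (Ico_subset_Icc_self ht)).mono_of_mem_nhdsWithin
        (Icc_mem_nhdsGE_of_mem ht)) (by rw [← hw0]) (fun t ht => by
          rw [add_zero]
          exact ((A t).le_opNorm _).trans (mul_le_mul (hK t (Ico_subset_Icc_self ht))
            (norm_cubeProj_le_norm hR _) (norm_nonneg _) hK0)) t ht
    rw [gronwallBound_ε0, sub_zero] at this
    refine this.trans ?_
    rw [hRdef]
    gcongr
    exact ht.2
  have := hw t ht
  simp only [cubeProj_of_norm_le hR (hbd t ht)] at this
  exact this

/-- Global existence for linear equations with continuous coefficients. -/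
theorem exists_linear_solution {n : ℕ} {A : ℝ → (Fin n → ℝ) →L[ℝ] (Fin n → ℝ)}
    (hA : ContinuousOn A (Ici 0)) (x₀ : Fin n → ℝ) :
    ∃ w : ℝ → (Fin n → ℝ), w 0 = x₀ ∧
      ∀ t, 0 ≤ t → HasDerivWithinAt w (A t (w t)) (Ici 0) t := by
  choose W hW0 hW using fun m : ℕ =>
    exists_linear_solution_Icc hA x₀ (T := (m : ℝ) + 1) (by positivity)
  have hcont : ∀ m, ContinuousOn (W m) (Icc 0 ((m : ℝ) + 1)) := fun m t ht =>
    (hW m t ht).continuousWithinAt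
  have agree : ∀ m m' : ℕ, m ≤ m' → ∀ t ∈ Icc 0 ((m : ℝ) + 1), W m t = W m' t := by
    intro m m' hmm
    have hle : (m : ℝ) + 1 ≤ (m' : ℝ) + 1 := by gcongr
    refine eq_of_linear_solution hA (hcont m) (fun t ht => ?_)
      ((hcont m').mono (Icc_subset_Icc_right hle)) (fun t ht => ?_) ((hW0 m).trans (hW0 m').symm)
    · exact (hW m t (Ico_subset_Icc_self ht)).mono_of_mem_nhdsWithin (Icc_mem_nhdsGE_of_mem ht)
    · have ht' : t ∈ Ico 0 ((m' : ℝ) + 1) := ⟨ht.1, ht.2.trans_le hle⟩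
      exact (hW m' t (Ico_subset_Icc_self ht')).mono_of_mem_nhdsWithin (Icc_mem_nhdsGE_of_mem ht')
  -- `W m` lives on `[0, m + 1]`, so near `t` there is room to the right of `t` for the derivative.
  refine ⟨fun t => W ⌊t⌋₊ t, by simp [hW0], fun t ht => ?_⟩
  have hlt : t < (⌊t⌋₊ : ℝ) + 1 := Nat.lt_floor_add_one t
  have hev : ∀ s, 0 ≤ s → s < (⌊t⌋₊ : ℝ) + 1 → W ⌊s⌋₊ s = W ⌊t⌋₊ s := by
    intro s hs hst
    refine agree _ _ ?_ s ⟨hs, (Nat.lt_floor_add_one s).le⟩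
    have : ⌊s⌋₊ < ⌊t⌋₊ + 1 := (Nat.floor_lt hs).2 (by exact_mod_cast hst)
    omega
  have h1 : HasDerivWithinAt (W ⌊t⌋₊) (A t (W ⌊t⌋₊ t)) (Ici 0) t := by
    refine (hW ⌊t⌋₊ t ⟨ht, hlt.le⟩).mono_of_mem_nhdsWithin ?_
    rw [mem_nhdsWithin]
    exact ⟨Iio ((⌊t⌋₊ : ℝ) + 1), isOpen_Iio, hlt, fun s hs => ⟨hs.2, hs.1.le⟩⟩
  refine h1.congr_of_eventuallyEq ?_ rfl
  have : Iio ((⌊t⌋₊ : ℝ) + 1) ∈ nhdsWithin t (Ici 0) :=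
    mem_nhdsWithin_of_mem_nhds (Iio_mem_nhds hlt)
  filter_upwards [this, self_mem_nhdsWithin] with s hs hs0
  exact hev s hs0 hs

/-! ### The variational equation along trajectories -/

/-- A jointly continuous function is uniformly close to its values along a curve, near that curve
and on compact time intervals. -/
theorem exists_forall_norm_sub_le_near_curve {n : ℕ} {F : Type*} [NormedAddCommGroup F]
    {D : ℝ → (Fin n → ℝ) → F}
    (hD : ContinuousOn (fun p : ℝ × (Fin n → ℝ) => D p.1 p.2) (Ici 0 ×ˢ univ))
    {u : ℝ → (Fin n → ℝ)} (hu : ContinuousOn u (Ici 0)) (T : ℝ) {ε : ℝ} (hε : 0 < ε) :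
    ∃ δ, 0 < δ ∧ ∀ t ∈ Icc 0 T, ∀ z, ‖z - u t‖ ≤ δ → ‖D t z - D t (u t)‖ ≤ ε := by
  obtain ⟨R, hR⟩ := isCompact_Icc.exists_bound_of_continuousOn
    (hu.mono (Icc_subset_Ici_self : Icc 0 T ⊆ _))
  have hcomp : IsCompact (Icc 0 T ×ˢ Metric.closedBall (0 : Fin n → ℝ) (R + 1)) :=
    isCompact_Icc.prod (isCompact_closedBall _ _)
  have huc := hcomp.uniformContinuousOn_of_continuous
    (hD.mono (prod_mono Icc_subset_Ici_self (subset_univ _)))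
  obtain ⟨δ, hδ, h⟩ := Metric.uniformContinuousOn_iff.1 huc ε hε
  -- The 1 keeps `z` in the compact ball; the half makes the distance strictly less than `δ`.
  refine ⟨min 1 (δ / 2), by positivity, fun t ht z hz => ?_⟩
  have hz1 : ‖z‖ ≤ R + 1 := by
    have := norm_add_le (u t) (z - u t)
    rw [add_sub_cancel] at this
    linarith [hR t ht, hz.trans (min_le_left _ _)]
  have hz2 : dist (t, z) (t, u t) < δ := by
    rw [dist_prod_same_left, dist_eq_norm]
    linarith [hz.trans (min_le_right _ _)]
  have := h (t, z) ⟨ht, by simpa using hz1⟩ (t, u t)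
    ⟨ht, by simpa using (hR t ht).trans (by linarith)⟩ hz2
  rw [dist_eq_norm] at this
  exact this.le

section Variational

variable {n : ℕ} {f : ℝ → (Fin n → ℝ) → (Fin n → ℝ)} {Ω : Set (Fin n → ℝ)}

theorem IsTrajectory.continuousOn {u : ℝ → (Fin n → ℝ)} (hu : IsTrajectory f Ω u) :
    ContinuousOn u (Ici 0) := fun t ht => (hu t ht).2.continuousWithinAt

theorem continuousOn_fderiv_along
    (hD : ContinuousOn (fun p : ℝ × (Fin n → ℝ) => fderiv ℝ (f p.1) p.2) (Ici 0 ×ˢ univ))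
    {u : ℝ → (Fin n → ℝ)} (hu : IsTrajectory f Ω u) :
    ContinuousOn (fun t => fderiv ℝ (f t) (u t)) (Ici 0) :=
  hD.comp (continuousOn_id.prodMk hu.continuousOn) fun _ ht => ⟨ht, trivial⟩

/-- If the variational equation along `u` is approximated, to every precision, by curves bounded
by `B`, then its solution is bounded by `B`. -/
theorem norm_le_of_forall_approx
    (hD : ContinuousOn (fun p : ℝ × (Fin n → ℝ) => fderiv ℝ (f p.1) p.2) (Ici 0 ×ˢ univ))
    {u : ℝ → (Fin n → ℝ)} (hu : IsTrajectory f Ω u) {w : ℝ → (Fin n → ℝ)}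
    (hw : ∀ t, 0 ≤ t → HasDerivWithinAt w (fderiv ℝ (f t) (u t) (w t)) (Ici 0) t)
    {B T : ℝ} (hT : 0 ≤ T)
    (happ : ∀ ε > 0, ∃ z z' : ℝ → (Fin n → ℝ), z 0 = w 0 ∧ ‖z T‖ ≤ B ∧
      (∀ t, 0 ≤ t → HasDerivWithinAt z (z' t) (Ici 0) t) ∧
      ∀ t ∈ Icc 0 T, ‖z' t - fderiv ℝ (f t) (u t) (z t)‖ ≤ ε) :
    ‖w T‖ ≤ B := by
  obtain ⟨K, hK⟩ := isCompact_Icc.exists_bound_of_continuousOn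
    ((continuousOn_fderiv_along hD hu).mono (Icc_subset_Ici_self : Icc 0 T ⊆ _))
  set G := (Real.exp (max K 1 * T) - 1) / max K 1 with hG
  have hG0 : 0 ≤ G := by
    have h1 : (1 : ℝ) ≤ Real.exp (max K 1 * T) := Real.one_le_exp (by positivity)
    exact div_nonneg (by linarith) (by positivity)
  refine le_of_forall_pos_le_add fun ε hε => ?_
  obtain ⟨z, z', h0, hzB, hz, hz'⟩ := happ (ε / (G + 1)) (by positivity)
  have key := norm_sub_le_of_approx_linear_solution (K := max K 1) (ε := ε / (G + 1))
    (by positivity)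
    (fun t ht => (hK t (Ico_subset_Icc_self ht)).trans (le_max_left _ _))
    (fun t ht => ((hz t ht.1).continuousWithinAt).mono Icc_subset_Ici_self)
    (fun t ht => (hz t ht.1).mono (Ici_subset_Ici.2 ht.1))
    (fun t ht => hz' t (Ico_subset_Icc_self ht))
    (fun t ht => ((hw t ht.1).continuousWithinAt).mono Icc_subset_Ici_self)
    (fun t ht => (hw t ht.1).mono (Ici_subset_Ici.2 ht.1)) h0 T ⟨hT, le_rfl⟩
  rw [← hG] at key
  have hle : ε / (G + 1) * G ≤ ε := by
    rw [div_mul_eq_mul_div, div_le_iff₀ (by positivity)]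
    nlinarith
  have := norm_sub_le (z T) (z T - w T)
  rw [sub_sub_cancel] at this
  linarith

variable (hf : ∀ t, 0 ≤ t → Differentiable ℝ (f t))
  (hD : ContinuousOn (fun p : ℝ × (Fin n → ℝ) => fderiv ℝ (f p.1) p.2) (Ici 0 ×ˢ univ))
  (hΩ_inv : ∀ a ∈ Ω, ∃ u, IsTrajectory f Ω u ∧ u 0 = a)
  {C : ℝ} (hC : 0 < C)
  (hstab : ∀ u v, IsTrajectory f Ω u → IsTrajectory f Ω v →
    ∀ t, 0 ≤ t → ‖u t - v t‖ ≤ C * ‖u 0 - v 0‖)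

include hf hD hΩ_inv hC hstab

open Filter Topology in
-- The approximants are difference quotients `(v - u) / h` with `v` started at `u 0 + h • w 0`,
-- which lies in `Ω` for small `h`. Stability bounds them independently of `h`, and the mean value
-- inequality makes their defect in the variational equation small.
theorem norm_variational_solution_le_of_mem_interior
    {u : ℝ → (Fin n → ℝ)} (hu : IsTrajectory f Ω u) (hu0 : u 0 ∈ interior Ω)
    {w : ℝ → (Fin n → ℝ)}
    (hw : ∀ t, 0 ≤ t → HasDerivWithinAt w (fderiv ℝ (f t) (u t) (w t)) (Ici 0) t)
    {T : ℝ} (hT : 0 ≤ T) : ‖w T‖ ≤ C * ‖w 0‖ := by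
  refine norm_le_of_forall_approx hD hu hw hT fun ε hε => ?_
  -- The defect will be at most `ε' * (C * ‖w 0‖)`; adding 1 covers `w 0 = 0`.
  set ε' := ε / (C * ‖w 0‖ + 1) with hε'def
  have hε' : 0 < ε' := by positivity
  obtain ⟨δ, hδ, hnear⟩ := exists_forall_norm_sub_le_near_curve
    (D := fun t x => fderiv ℝ (f t) x) hD hu.continuousOn T hε'
  have hev : ∀ᶠ h in 𝓝[>] (0 : ℝ), u 0 + h • w 0 ∈ Ω ∧ C * (h * ‖w 0‖) < δ := by
    have h1 : Tendsto (fun h : ℝ => u 0 + h • w 0) (𝓝 0) (𝓝 (u 0)) := by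
      have : Continuous fun h : ℝ => u 0 + h • w 0 := by fun_prop
      simpa using this.tendsto 0
    have h2 : Tendsto (fun h : ℝ => C * (h * ‖w 0‖)) (𝓝 0) (𝓝 0) := by
      have : Continuous fun h : ℝ => C * (h * ‖w 0‖) := by fun_prop
      simpa using this.tendsto 0
    exact nhdsWithin_le_nhds ((h1.eventually (mem_interior_iff_mem_nhds.1 hu0)).and
      (h2.eventually (gt_mem_nhds hδ)))
  obtain ⟨h, ⟨hmem, hsmall⟩, hpos⟩ := (hev.and self_mem_nhdsWithin).exists
  replace hpos : 0 < h := hpos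
  obtain ⟨v, hv, hv0⟩ := hΩ_inv _ hmem
  have hvu : ∀ t, 0 ≤ t → ‖v t - u t‖ ≤ C * (h * ‖w 0‖) := by
    intro t ht
    have := hstab v u hv hu t ht
    rwa [hv0, add_sub_cancel_left, norm_smul, Real.norm_of_nonneg hpos.le] at this
  have hz : ∀ t, 0 ≤ t → ‖h⁻¹ • (v t - u t)‖ ≤ C * ‖w 0‖ := by
    intro t ht
    rw [norm_smul, norm_inv, Real.norm_of_nonneg hpos.le, inv_mul_le_iff₀ hpos]
    linarith [hvu t ht]
  refine ⟨fun t => h⁻¹ • (v t - u t), fun t => h⁻¹ • (f t (v t) - f t (u t)), ?_, hz T hT,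
    fun t ht => ((hv t ht).2.fun_sub (hu t ht).2).fun_const_smul h⁻¹, fun t ht => ?_⟩
  · simp [hv0, smul_smul, hpos.ne']
  · have hmv := Convex.norm_image_sub_le_of_norm_fderiv_le' (𝕜 := ℝ) (f := f t)
      (φ := fderiv ℝ (f t) (u t)) (C := ε') (s := Metric.closedBall (u t) δ)
      (x := u t) (y := v t) (fun x _ => hf t ht.1 x)
      (fun x hx => hnear t ht x (by simpa [dist_eq_norm] using hx)) (convex_closedBall _ _)
      (by simp [hδ.le])
      (by rw [Metric.mem_closedBall, dist_eq_norm]; exact (hvu t ht.1).trans hsmall.le)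
    have heq : h⁻¹ • (f t (v t) - f t (u t)) - fderiv ℝ (f t) (u t) (h⁻¹ • (v t - u t)) =
        h⁻¹ • (f t (v t) - f t (u t) - fderiv ℝ (f t) (u t) (v t - u t)) := by
      rw [map_smul, smul_sub h⁻¹ (f t (v t) - f t (u t))]
    calc _ = h⁻¹ * ‖f t (v t) - f t (u t) - fderiv ℝ (f t) (u t) (v t - u t)‖ := by
          rw [heq, norm_smul, norm_inv, Real.norm_of_nonneg hpos.le]
      _ ≤ h⁻¹ * (ε' * ‖v t - u t‖) := by gcongr
      _ = ε' * ‖h⁻¹ • (v t - u t)‖ := by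
          rw [norm_smul, norm_inv, Real.norm_of_nonneg hpos.le]; ring
      _ ≤ ε' * (C * ‖w 0‖) := by gcongr; exact hz t ht.1
      _ ≤ ε := by
          rw [hε'def, div_mul_eq_mul_div, div_le_iff₀ (by positivity)]
          nlinarith

/-- Uniform incremental stability bounds the solutions of the variational equation. -/
theorem norm_variational_solution_le (hΩ_dim : Ω ⊆ closure (interior Ω))
    {u : ℝ → (Fin n → ℝ)} (hu : IsTrajectory f Ω u) {w : ℝ → (Fin n → ℝ)}
    (hw : ∀ t, 0 ≤ t → HasDerivWithinAt w (fderiv ℝ (f t) (u t) (w t)) (Ici 0) t)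
    {T : ℝ} (hT : 0 ≤ T) : ‖w T‖ ≤ C * ‖w 0‖ := by
  refine norm_le_of_forall_approx hD hu hw hT fun ε hε => ?_
  set ε' := ε / (C * ‖w 0‖ + 1) with hε'def
  have hε' : 0 < ε' := by positivity
  obtain ⟨δ, hδ, hnear⟩ := exists_forall_norm_sub_le_near_curve
    (D := fun t x => fderiv ℝ (f t) x) hD hu.continuousOn T hε'
  -- From a boundary point some perturbations may leave `Ω`, so the approximant is the variational
  -- solution along a trajectory started at a nearby interior point. Stability turns `δ / C` into
  -- distance at most `δ` for all time.
  obtain ⟨a, ha, hdist⟩ := Metric.mem_closure_iff.1 (hΩ_dim (hu 0 le_rfl).1) (δ / C)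
    (by positivity)
  obtain ⟨v, hv, rfl⟩ := hΩ_inv a (interior_subset ha)
  obtain ⟨z, hz0, hz⟩ := exists_linear_solution (continuousOn_fderiv_along hD hv) (w 0)
  have hzb : ∀ t, 0 ≤ t → ‖z t‖ ≤ C * ‖w 0‖ := fun t ht => hz0 ▸
    norm_variational_solution_le_of_mem_interior hf hD hΩ_inv hC hstab hv ha hz ht
  refine ⟨z, _, hz0, hzb T hT, hz, fun t ht => ?_⟩
  have hvu : ‖v t - u t‖ ≤ δ := by
    refine (hstab v u hv hu t ht.1).trans ?_
    rw [← dist_eq_norm, dist_comm]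
    have := (lt_div_iff₀ hC).1 hdist
    linarith
  calc _ = ‖(fderiv ℝ (f t) (v t) - fderiv ℝ (f t) (u t)) (z t)‖ := rfl
    _ ≤ ‖fderiv ℝ (f t) (v t) - fderiv ℝ (f t) (u t)‖ * ‖z t‖ := ContinuousLinearMap.le_opNorm _ _
    _ ≤ ε' * (C * ‖w 0‖) := by
        gcongr
        · exact hnear t ht _ hvu
        · exact hzb t ht.1
    _ ≤ ε := by
        rw [hε'def, div_mul_eq_mul_div, div_le_iff₀ (by positivity)]
        nlinarith

end Variational

/-! ### From horizontal contraction to `k`-contraction -/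

section Contraction

variable {n : ℕ} {f : ℝ → (Fin n → ℝ) → (Fin n → ℝ)} {Ω : Set (Fin n → ℝ)}

theorem jacobian_mulVec (t : ℝ) (x w : Fin n → ℝ) :
    jacobian f t x *ᵥ w = fderiv ℝ (f t) x w := by
  simp [jacobian, LinearMap.toMatrix'_mulVec]

theorem continuousOn_fderiv_of_jacobian
    (hJ : ContinuousOn (fun p : ℝ × (Fin n → ℝ) => jacobian f p.1 p.2) (Ici 0 ×ˢ univ)) :
    ContinuousOn (fun p : ℝ × (Fin n → ℝ) => fderiv ℝ (f p.1) p.2) (Ici 0 ×ˢ univ) := by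
  refine continuousOn_clm_apply.2 fun w => ?_
  simp_rw [← jacobian_mulVec]
  exact (continuous_id.matrix_mulVec continuous_const).comp_continuousOn hJ

theorem stackTranspose_mulVec_of_lt {ℓ : ℕ} (H : Matrix (Fin n) (Fin ℓ) ℝ)
    (Q : Matrix (Fin n) (Fin (n - ℓ)) ℝ) (v : Fin n → ℝ) (i : Fin n) (hi : (i : ℕ) < ℓ) :
    (stackTranspose H Q *ᵥ v) i = (Hᵀ *ᵥ v) ⟨i, hi⟩ := by
  simp [stackTranspose, Matrix.mulVec, dotProduct, hi]

theorem norm_transpose_mulVec_le {ℓ : ℕ} (hℓ : ℓ ≤ n) (H : Matrix (Fin n) (Fin ℓ) ℝ)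
    (Q : Matrix (Fin n) (Fin (n - ℓ)) ℝ) (v : Fin n → ℝ) :
    ‖Hᵀ *ᵥ v‖ ≤ ‖stackTranspose H Q *ᵥ v‖ := by
  refine (pi_norm_le_iff_of_nonneg (norm_nonneg _)).2 fun i => ?_
  have := stackTranspose_mulVec_of_lt H Q v ⟨i, i.2.trans_le hℓ⟩ i.2
  rw [← this]
  exact norm_le_pi_norm _ _

/-- The horizontal part of the solutions of the variational equation decays. -/
theorem IsHorizontallyContractive.exists_norm_transpose_mulVec_le {ℓ : ℕ} (hℓ : ℓ ≤ n)
    {H : (Fin n → ℝ) → Matrix (Fin n) (Fin ℓ) ℝ}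
    {Q : (Fin n → ℝ) → Matrix (Fin n) (Fin (n - ℓ)) ℝ}
    (hHQ : IsHorizontalSplitting Ω H Q) (h_hor : IsHorizontallyContractive f Ω H Q)
    (hH_bdd : HasUniformBounds Ω fun x => (H x)ᵀ * H x)
    (hM_bdd : HasUniformBounds Ω fun x => stackTranspose (H x) (Q x)) :
    ∃ C, 0 < C ∧ ∃ η : ℝ, 0 < η ∧ ∀ u, IsTrajectory f Ω u →
      ∀ w, IsLinearSolution (fun t => jacobian f t (u t)) w →
      ∀ t, 0 ≤ t → ‖(H (u t))ᵀ *ᵥ w t‖ ≤ C * Real.exp (-η * t) * ‖w 0‖ := by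
  obtain ⟨N, hN, c, hc, η, hη, h⟩ := h_hor
  obtain ⟨b, hb, hNb⟩ := N.exists_le_mul_norm
  obtain ⟨a, ha, hNa⟩ := hN.exists_norm_le_mul
  obtain ⟨CH, hCH, hH⟩ := hH_bdd.exists_norm
  obtain ⟨CM, hCM, hM⟩ := hM_bdd.exists_norm
  refine ⟨CH * (a * (c * (b * (CH * CM)))), by positivity, η, hη, fun u hu w hw t ht => ?_⟩
  have hdec : ∀ t, ∃ p : (Fin ℓ → ℝ) × (Fin (n - ℓ) → ℝ),
      0 ≤ t → w t = H (u t) *ᵥ p.1 + Q (u t) *ᵥ p.2 := by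
    intro t
    by_cases ht : 0 ≤ t
    · obtain ⟨p, hp, -⟩ := hHQ.decomposition (u t) (hu t ht).1 (w t)
      exact ⟨p, fun _ => hp⟩
    · exact ⟨0, fun h => absurd h ht⟩
  choose p hp using hdec
  -- Orthogonality removes the vertical part, so `Hᵀ w` and the horizontal coordinates are
  -- comparable through `HᵀH`.
  have hrel : ∀ t, 0 ≤ t → (H (u t))ᵀ *ᵥ w t = ((H (u t))ᵀ * H (u t)) *ᵥ (p t).1 := by
    intro t ht
    rw [hp t ht, Matrix.mulVec_add, Matrix.mulVec_mulVec, Matrix.mulVec_mulVec,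
      hHQ.orthogonal _ (hu t ht).1, Matrix.zero_mulVec, add_zero]
  have h0 := hu 0 le_rfl
  have h1 : ‖(p 0).1‖ ≤ CH * (CM * ‖w 0‖) := by
    refine ((hH _ h0.1 _).2).trans ?_
    rw [← hrel 0 le_rfl]
    gcongr
    exact (norm_transpose_mulVec_le hℓ _ (Q (u 0)) _).trans (hM _ h0.1 _).1
  have h2 := h u hu w hw (fun t => (p t).1) (fun t => (p t).2) hp t ht
  calc ‖(H (u t))ᵀ *ᵥ w t‖ ≤ CH * ‖(p t).1‖ := by
        rw [hrel t ht]; exact (hH _ (hu t ht).1 _).1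
    _ ≤ CH * (a * (c * Real.exp (-η * t) * (b * (CH * (CM * ‖w 0‖))))) := by
        gcongr
        refine (hNa _).trans ?_
        gcongr
        refine h2.trans ?_
        gcongr
        exact (hNb _).trans (mul_le_mul_of_nonneg_left h1 hb.le)
    _ = _ := by ring

theorem norm_mulVec_le_of_entry_bound {ι : Type} [Fintype ι] (A : Matrix ι ι ℝ) {b : ℝ}
    (hb : 0 ≤ b) (hA : ∀ i j, |A i j| ≤ b) (v : ι → ℝ) :
    ‖A *ᵥ v‖ ≤ Fintype.card ι * b * ‖v‖ := by
  refine (pi_norm_le_iff_of_nonneg (by positivity)).2 fun i => ?_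
  rw [Real.norm_eq_abs, Matrix.mulVec, dotProduct]
  refine (Finset.abs_sum_le_sum_abs _ _).trans ?_
  have : ∀ j ∈ Finset.univ, |A i j * v j| ≤ b * ‖v‖ := fun j _ => by
    rw [abs_mul]
    exact mul_le_mul (hA i j) (norm_le_pi_norm v j) (abs_nonneg _) hb
  refine (Finset.sum_le_card_nsmul _ _ _ this).trans (le_of_eq ?_)
  rw [nsmul_eq_mul, Finset.card_univ, mul_assoc]

/-- The least of `k` distinct indices below `n` is at most `n - k`. -/
theorem orderEmbedding_zero_lt {k ℓ : ℕ} (hℓ : ℓ = n - k) (α : Fin (k + 1) ↪o Fin n) :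
    (α 0 : ℕ) < ℓ := by
  have h : ∀ i : Fin (k + 1), (α 0 : ℕ) + i ≤ α i := by
    intro i
    induction i using Fin.induction with
    | zero => simp
    | succ i ih =>
      have : α i.castSucc < α i.succ := α.strictMono Fin.castSucc_lt_succ
      rw [Fin.lt_def] at this
      simp only [Fin.val_castSucc, Fin.val_succ] at ih ⊢
      omega
  have h1 := h (Fin.last k)
  have h2 := (α (Fin.last k)).2
  simp only [Fin.val_last] at h1
  omega

/-- If the first `n - k` rows of `A` are bounded by `b` and the others by `B`, each minor of order
`k + 1` involves at least one of the former. -/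
theorem abs_multCompound_le {k ℓ : ℕ} (hℓ : ℓ = n - k) (A : Matrix (Fin n) (Fin n) ℝ) {b B : ℝ}
    (hb : ∀ (i : Fin n) j, (i : ℕ) < ℓ → |A i j| ≤ b) (hB : ∀ i j, |A i j| ≤ B)
    (α β : Fin (k + 1) ↪o Fin n) :
    |multCompound (k + 1) A α β| ≤ (k + 1).factorial * (b * B ^ k) := by
  -- The rows are in increasing order, so row 0 is surely among the first `ℓ`; the other `k` rows
  -- get the crude bound.
  refine (abs_det_le_of_row_bound _ (Fin.cons b fun _ => B) fun i j => ?_).trans (le_of_eq ?_)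
  · refine Fin.cases ?_ (fun i => ?_) i
    · simpa using hb _ _ (orderEmbedding_zero_lt hℓ α)
    · simpa using hB _ _
  · simp [Fin.prod_univ_succ]

theorem isLinearSolution_multCompound_mulVec (k : ℕ) {A X : ℝ → Matrix (Fin n) (Fin n) ℝ}
    (hX : ∀ j, IsLinearSolution A fun t i => X t i j) (v : (Fin k ↪o Fin n) → ℝ) :
    IsLinearSolution (fun t => addCompound k (A t)) fun t => multCompound k (X t) *ᵥ v := by
  intro t ht
  refine hasDerivWithinAt_pi.2 fun α => ?_
  rw [Matrix.mulVec_mulVec]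
  refine HasDerivWithinAt.fun_sum fun β _ => HasDerivWithinAt.mul_const ?_ _
  refine hasDerivWithinAt_multCompound k (fun i j => ?_) α β
  exact hasDerivWithinAt_pi.1 (hX j t ht) i

theorem IsLinearSolution.eq_of_continuousOn {ι : Type} [Fintype ι] {A : ℝ → Matrix ι ι ℝ}
    (hA : ContinuousOn A (Ici 0)) {y z : ℝ → (ι → ℝ)} (hy : IsLinearSolution A y)
    (hz : IsLinearSolution A z) (h0 : y 0 = z 0) {t : ℝ} (ht : 0 ≤ t) : y t = z t := by
  have hcont : ContinuousOn (fun t => LinearMap.toContinuousLinearMap (A t).mulVecLin) (Ici 0) := by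
    refine continuousOn_clm_apply.2 fun w => ?_
    exact (continuous_id.matrix_mulVec continuous_const).comp_continuousOn hA
  exact eq_of_linear_solution (T := t) hcont
    (fun s hs => ((hy s hs.1).continuousWithinAt).mono Icc_subset_Ici_self)
    (fun s hs => (hy s hs.1).mono (Ici_subset_Ici.2 hs.1))
    (fun s hs => ((hz s hs.1).continuousWithinAt).mono Icc_subset_Ici_self)
    (fun s hs => (hz s hs.1).mono (Ici_subset_Ici.2 hs.1)) h0 t ⟨ht, le_rfl⟩

theorem exists_fundamental_matrix
    (hJ : ContinuousOn (fun p : ℝ × (Fin n → ℝ) => jacobian f p.1 p.2) (Ici 0 ×ˢ univ))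
    {u : ℝ → (Fin n → ℝ)} (hu : IsTrajectory f Ω u) :
    ∃ X : ℝ → Matrix (Fin n) (Fin n) ℝ, X 0 = 1 ∧
      ∀ j, IsLinearSolution (fun t => jacobian f t (u t)) fun t i => X t i j := by
  choose w hw0 hw using fun j : Fin n => exists_linear_solution
    (continuousOn_fderiv_along (continuousOn_fderiv_of_jacobian hJ) hu) (Pi.single j (1 : ℝ))
  refine ⟨fun t => Matrix.of fun i j => w j t i, ?_, fun j t ht => ?_⟩
  · ext i j
    simp [hw0, Pi.single_apply, Matrix.one_apply]
  · rw [jacobian_mulVec]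
    exact hw j t ht

end Contraction

theorem IsUniformlyIncrementallyStable.exists_norm {n : ℕ}
    {f : ℝ → (Fin n → ℝ) → (Fin n → ℝ)} {Ω : Set (Fin n → ℝ)}
    (h : IsUniformlyIncrementallyStable f Ω) :
    ∃ C, 0 < C ∧ ∀ u v, IsTrajectory f Ω u → IsTrajectory f Ω v →
      ∀ t, 0 ≤ t → ‖u t - v t‖ ≤ C * ‖u 0 - v 0‖ := by
  obtain ⟨N, hN, γ, hγ, h⟩ := h
  obtain ⟨b, hb, hNb⟩ := N.exists_le_mul_norm
  obtain ⟨a, ha, hNa⟩ := hN.exists_norm_le_mul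
  have hγ0 : 0 < γ := by linarith
  refine ⟨a * (γ * b), by positivity, fun u v hu hv t ht => ?_⟩
  calc _ ≤ a * N (u t - v t) := hNa _
    _ ≤ a * (γ * (b * ‖u 0 - v 0‖)) := by
        gcongr
        exact (h u v hu hv t ht).trans (mul_le_mul_of_nonneg_left (hNb _) hγ0.le)
    _ = _ := by ring

theorem theorem2 (n k ℓ : ℕ) (hk : 1 ≤ k) (hkn : k ≤ n) (hℓ : ℓ = n - k + 1)
    (f : ℝ → (Fin n → ℝ) → (Fin n → ℝ)) (Ω : Set (Fin n → ℝ))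
    (hf : ∀ t, 0 ≤ t → Differentiable ℝ (f t))
    (hJ : ContinuousOn (fun p : ℝ × (Fin n → ℝ) => jacobian f p.1 p.2) (Set.Ici 0 ×ˢ Set.univ))
    (hΩ_closed : IsClosed Ω) (hΩ_conn : IsConnected Ω) (hΩ_dim : Ω ⊆ closure (interior Ω))
    (hΩ_inv : ∀ a ∈ Ω, ∃ u, IsTrajectory f Ω u ∧ u 0 = a)
    (H : (Fin n → ℝ) → Matrix (Fin n) (Fin ℓ) ℝ)
    (Q : (Fin n → ℝ) → Matrix (Fin n) (Fin (n - ℓ)) ℝ)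
    (hHQ : IsHorizontalSplitting Ω H Q)
    (h_hor : IsHorizontallyContractive f Ω H Q)
    (hH_bdd : HasUniformBounds Ω fun x => (H x)ᵀ * H x)
    (hM_bdd : HasUniformBounds Ω fun x => stackTranspose (H x) (Q x))
    (hMk_bdd : HasUniformBounds Ω fun x => multCompound k (stackTranspose (H x) (Q x)))
    (h_stab : IsUniformlyIncrementallyStable f Ω) :
    IsKContractive f Ω k := by
  obtain ⟨k, rfl⟩ : ∃ m, k = m + 1 := ⟨k - 1, by omega⟩
  have hℓ' : ℓ = n - k := by omega
  have hℓn : ℓ ≤ n := by omega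
  obtain ⟨Cs, hCs, hs⟩ := h_stab.exists_norm
  obtain ⟨Ch, hCh, η, hη, hh⟩ := h_hor.exists_norm_transpose_mulVec_le hℓn hHQ hH_bdd hM_bdd
  obtain ⟨CM, hCM, hM⟩ := hM_bdd.exists_norm
  obtain ⟨CK, hCK, hK⟩ := hMk_bdd.exists_norm
  set c : ℝ := CK * (Fintype.card (Fin (k + 1) ↪o Fin n) *
    ((k + 1).factorial * (Ch * (CM * Cs) ^ k))) with hc
  have hc0 : 0 ≤ c := by positivity
  -- Adding 1 secures the required constant at least 1; the rate is that of horizontal contraction.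
  refine ⟨normSeminorm ℝ _, isVectorNorm_normSeminorm, c + 1, by linarith, η, hη,
    fun u hu y hy t ht => ?_⟩
  obtain ⟨X, hX0, hX⟩ := exists_fundamental_matrix hJ hu
  have hJu : ContinuousOn (fun t => jacobian f t (u t)) (Ici 0) :=
    hJ.comp (continuousOn_id.prodMk hu.continuousOn) fun _ ht => ⟨ht, trivial⟩
  have hyX : y t = multCompound (k + 1) (X t) *ᵥ y 0 := by
    refine IsLinearSolution.eq_of_continuousOn
      ((continuous_addCompound (k + 1) n).comp_continuousOn hJu) hy
      (isLinearSolution_multCompound_mulVec (k + 1) hX (y 0)) ?_ ht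
    rw [hX0, multCompound_one, Matrix.one_mulVec]
  have hcol0 : ∀ j, ‖fun i => X 0 i j‖ ≤ 1 := by
    intro j
    refine (pi_norm_le_iff_of_nonneg zero_le_one).2 fun i => ?_
    rw [hX0, Matrix.one_apply]
    split_ifs <;> simp
  set M := stackTranspose (H (u t)) (Q (u t)) with hMdef
  have hMX : ∀ i j, (M * X t) i j = (M *ᵥ fun i => X t i j) i := fun i j => rfl
  have hb : ∀ (i : Fin n) j, (i : ℕ) < ℓ → |(M * X t) i j| ≤ Ch * Real.exp (-η * t) := by
    intro i j hi
    rw [hMX, stackTranspose_mulVec_of_lt _ _ _ _ hi, ← Real.norm_eq_abs]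
    refine (norm_le_pi_norm _ _).trans ((hh u hu _ (hX j) t ht).trans ?_)
    exact mul_le_of_le_one_right (by positivity) (hcol0 j)
  have hB : ∀ i j, |(M * X t) i j| ≤ CM * Cs := by
    intro i j
    rw [hMX, ← Real.norm_eq_abs]
    refine (norm_le_pi_norm _ _).trans (((hM _ (hu t ht).1 _).1).trans ?_)
    gcongr
    refine (norm_variational_solution_le (w := fun t i => X t i j) hf
      (continuousOn_fderiv_of_jacobian hJ) hΩ_inv hCs hs hΩ_dim hu
      (fun t ht => ?_) ht).trans (mul_le_of_le_one_right hCs.le (hcol0 j))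
    rw [← jacobian_mulVec]
    exact hX j t ht
  have hy_le : ‖y t‖ ≤ c * Real.exp (-η * t) * ‖y 0‖ := by
    refine ((hK _ (hu t ht).1 _).2).trans ?_
    -- With `M^{(k)}` inverted at the price of `CK`, only the minors of `M X` remain to be
    -- estimated.
    rw [hyX, Matrix.mulVec_mulVec, ← multCompound_mul]
    calc _ ≤ CK * (Fintype.card (Fin (k + 1) ↪o Fin n) *
            ((k + 1).factorial * (Ch * Real.exp (-η * t) * (CM * Cs) ^ k)) * ‖y 0‖) := by
          gcongr
          exact norm_mulVec_le_of_entry_bound _ (by positivity)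
            (abs_multCompound_le hℓ' _ hb hB) _
      _ = _ := by rw [hc]; ring
  change ‖y t‖ ≤ (c + 1) * Real.exp (-η * t) * ‖y 0‖
  refine hy_le.trans ?_
  gcongr
  linarith
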